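/- Let $d_1,d_2,d_3,\dots$ be positive integers and let $\alpha=[0;1+d_1,d_2,d_3,\dots]$. Let $c_\alpha$ be the characteristic Sturmian word of slope $\alpha$ over $\{a,b\}$, i.e. the infinite word whose $m$-th letter ($m\ge 1$) is $a$ if $\lfloor (m+1)\alpha\rfloor=\lfloor m\alpha\rfloor$ and $b$ otherwise. Put $s_{-1}=b$, $s_0=a$, $s_n=s_{n-1}^{d_n}s_{n-2}$ for $n\ge1$. Define the singular words by $w_{-1}=a$ and, for $n\ge 0$, $w_n=as_nb^{-1}$ if $n$ is odd and $w_n=bs_na^{-1}$ if $n$ is even; define the adjoining singular words, for $n\ge-1$, by $v_n=as_{n+1}^{d_{n+2}-1}s_nb^{-1}$ if $n$ is odd and $v_n=bs_{n+1}^{d_{n+2}-1}s_na^{-1}$ if $n$ is even. For $n\ge1$ and $0\le k\le d_{n+1}-1$ let $U_{n,k}=(w_{n-1}v_{n-2})^kw_{n-1}$, and set $U_{n,-1}=(v_{n-2})^{-1}$, an element of the free group on $\{a,b\}$. Writing $\alpha=[0;a_1,a_2,\dots]$, so that $a_1=1+d_1$ and $a_i=d_i$ for $i\ge2$, put $\alpha_{n,k}=[0;a_{n+1}+k,a_{n+2},a_{n+3},\dots]$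 for $n \ge 0$ and integers $k\ge 1-a_{n+1}$, and $\alpha_n=\alpha_{n,0}$. For elements $x,y$ of the free group, "$z_1z_2z_3\cdots$ is given by $c_\gamma$ over $\{x,y\}$" means that $z_i=x$ if the $i$-th letter of $c_\gamma$ is $a$, and $z_i=y$ if it is $b$. For finite words $P,u$, the equation $c_\alpha=P\,u^{(1)}z_1u^{(2)}z_2u^{(3)}z_3\cdots$ means that $u$ occurs infinitely often in $c_\alpha$, that $u^{(i)}$ is its $i$-th occurrence (in order of position, all occurrences being counted, overlapping ones included), and that for every $i\ge1$ the prefix of $c_\alpha$ preceding the $i$-th occurrence of $u$ equals $P\,u z_1 u z_2\cdots u z_{i-1}$ in the free group. Then: 1. For all $n\ge1$ and $0\le k\le d_{n+1}-1$, $$c_\alpha=\Big(\prod_{j=-1}^{n-2}v_j\Big)U_{n,k}^{(1)}z_1U_{n,k}^{(2)}z_2U_{n,k}^{(3)}z_3\cdots,$$ where $z_1z_2z_3\cdots$ is given by $c_{\alpha_{n,-k}}$ over $\{(U_{n,k-1})^{-1},\,w_n\}$. 2. In particular, for all $n\ge0$, $$c_\alpha=\Big(\prod_{j=-1}^{n-1}v_j\Big)w_n^{(1)}z_1w_n^{(2)}z_2w_n^{(3)}z_3\cdots,$$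 where $z_1z_2z_3\cdots$ is given by $c_{\alpha_{n+1}}$ over $\{v_{n-1},\,w_{n+1}\}$. 3. In particular, for all $n\ge0$, $$c_\alpha=\Big(\prod_{j=-1}^{n-1}v_j\Big)v_n^{(1)}z_1v_n^{(2)}z_2v_n^{(3)}z_3\cdots,$$ where $z_1z_2z_3\cdots$ is given by $c_{\alpha_{n+2,1}}$ over $\{w_{n+1},\,(U_{n+1,d_{n+2}-2})^{-1}\}$. -/

import Mathlib

open Filter Topology

namespace Sturmian

/-! ### Words, and their images in the free group -/

/-- The two-letter alphabet `{a, b}`. -/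
inductive Letter where
  | a : Letter
  | b : Letter
  deriving DecidableEq

/-- Finite words over `{a, b}`. -/
abbrev Word := List Letter

/-- The `k`-th power of a finite word. -/
def wpow (u : Word) (k : ℕ) : Word := (List.replicate k u).flatten

/-- The element of the free group on `{a, b}` given by a finite word. -/
def toFree (u : Word) : FreeGroup Letter := (u.map FreeGroup.of).prod

/-- The prefix of length `m` of an infinite word. -/
def pre (c : ℕ → Letter) (m : ℕ) : Word := (List.range m).map c

/-- The finite word `u` occurs at position `m` of the infinite word `c`. -/
def OccursAt (u : Word) (c : ℕ → Letter) (m : ℕ) : Prop :=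
  ∀ i (hi : i < u.length), c (m + i) = u[i]

/-- The infinite word `x` written over the alphabet `{g, h}`: replace `a` by `g` and `b` by `h`. -/
def overAlphabet (x : ℕ → Letter) (g h : FreeGroup Letter) : ℕ → FreeGroup Letter :=
  fun i => match x i with
    | Letter.a => g
    | Letter.b => h

/-- `c = P u⁽¹⁾ z₁ u⁽²⁾ z₂ u⁽³⁾ z₃ ⋯`, where `u⁽ⁱ⁾` is the `i`-th occurrence of `u` in `c` and the
`zᵢ` (here `z 0 = z₁, z 1 = z₂, …`) are elements of the free group. The sequence `p` lists all
positions at which `u` occurs in `c`, in increasing order, and the part of `c` that precedes the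
`(i+1)`-st occurrence is `P u z₁ u z₂ ⋯ u zᵢ`. -/
def IsOccurrenceDecomposition (c : ℕ → Letter) (P u : Word) (z : ℕ → FreeGroup Letter) : Prop :=
  ∃ p : ℕ → ℕ, StrictMono p ∧ Set.range p = {m | OccursAt u c m} ∧
    ∀ i, toFree (pre c (p i)) =
      toFree P * ((List.range i).map (fun j => toFree u * z j)).prod

/-! ### Sturmian words and continued fractions -/

/-- The Sturmian word `s_{α,ρ}` of slope `α` and intercept `ρ`. -/
noncomputable def sturmianWord (α ρ : ℝ) (n : ℕ) : Letter :=
  if ⌊((n : ℝ) + 1) * α + ρ⌋ - ⌊(n : ℝ) * α + ρ⌋ = 0 then Letter.a else Letter.b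

/-- The characteristic Sturmian word `c_α`, determined by `s_{α,0} = a c_α`. -/
noncomputable def charWord (α : ℝ) (n : ℕ) : Letter := sturmianWord α 0 (n + 1)

theorem sturmianWord_zero {α : ℝ} (h0 : 0 ≤ α) (h1 : α < 1) :
    sturmianWord α 0 0 = Letter.a := by
  have : ⌊α⌋ = 0 := Int.floor_eq_zero_iff.2 ⟨h0, h1⟩
  simp [sturmianWord, this]

/-- The infinite continued fraction `[0; a 1, a 2, a 3, …]` as a formal object
(the value `a 0` is not used). -/
def contFrac (a : ℕ → ℤ) : GenContFract ℝ where
  h := 0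
  s := Stream'.Seq.ofStream (Stream'.nats.map (fun i => ⟨1, (a (i + 1) : ℝ)⟩))

/-- The real number `[0; a 1, a 2, a 3, …]`, the limit of `[0; a 1, …, a N]` as `N → ∞`. -/
noncomputable def cfVal (a : ℕ → ℤ) : ℝ :=
  limUnder atTop (fun N : ℕ => (contFrac a).convs' N)

/-- If `γ = [0; a 1, a 2, …]`, this is `γ_{n,k} = [0; a (n+1) + k, a (n+2), a (n+3), …]`. -/
noncomputable def cfShift (a : ℕ → ℤ) (n : ℕ) (k : ℤ) : ℝ :=
  cfVal (fun i => if i = 1 then a (n + 1) + k else a (n + i))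

/-- The partial quotients `1 + d₁, d₂, d₃, …` (the value at `0` is not used). -/
def quotients (d : ℕ → ℕ) (i : ℕ) : ℤ := if i = 1 then 1 + (d 1 : ℤ) else (d i : ℤ)

/-! ### The standard sequence, singular words and adjoining singular words -/

/-- The standard sequence with its index raised by one, `stdWord d m = s_{m-1}`:
`s_{-1} = b`, `s_0 = a`, `s_n = s_{n-1}^{d_n} s_{n-2}`. -/
def stdWord (d : ℕ → ℕ) : ℕ → Word
  | 0 => [Letter.b]
  | 1 => [Letter.a]
  | m + 2 => wpow (stdWord d (m + 1)) (d (m + 1)) ++ stdWord d m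

/-- The singular words with their index raised by two, `singWord d m = w_{m-2}`: `w_{-2} = ε`,
`w_{-1} = a`, and for `n ≥ 0`, `w_n = a s_n b⁻¹` if `n` is odd, `w_n = b s_n a⁻¹` if `n` is even.
Cancelling the last letter on the right is `List.dropLast`. -/
def singWord (d : ℕ → ℕ) : ℕ → Word
  | 0 => []
  | 1 => [Letter.a]
  | n + 2 => (if Even n then Letter.b else Letter.a) :: (stdWord d (n + 1)).dropLast

/-- The adjoining singular words with their index raised by two, `adjWord d m = v_{m-2}`:
`v_{-2} = ε`, and for `n ≥ -1`, `v_n = a s_{n+1}^{d_{n+2}-1} s_n b⁻¹` if `n` is odd,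
`v_n = b s_{n+1}^{d_{n+2}-1} s_n a⁻¹` if `n` is even. Below, `n = m - 1`. -/
def adjWord (d : ℕ → ℕ) : ℕ → Word
  | 0 => []
  | m + 1 => (if Even m then Letter.a else Letter.b) ::
      (wpow (stdWord d (m + 1)) (d (m + 1) - 1) ++ stdWord d m).dropLast

theorem stdWord_last (d : ℕ → ℕ) (m : ℕ) :
    ∃ u, stdWord d m = u ++ [if Even m then Letter.b else Letter.a] := by
  induction m using Nat.strong_induction_on with
  | _ m ih =>
    match m, ih with
    | 0, _ => exact ⟨[], by simp [stdWord]⟩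
    | 1, _ => exact ⟨[], by simp [stdWord]⟩
    | m + 2, ih =>
      obtain ⟨u, hu⟩ := ih m (by omega)
      refine ⟨wpow (stdWord d (m + 1)) (d (m + 1)) ++ u, ?_⟩
      rw [stdWord, hu, List.append_assoc]
      simp [Nat.even_add]

/-- `w_n b = a s_n` for odd `n` and `w_n a = b s_n` for even `n`. -/
theorem singWord_append (d : ℕ → ℕ) (n : ℕ) :
    singWord d (n + 2) ++ [if Even n then Letter.a else Letter.b] =
      (if Even n then Letter.b else Letter.a) :: stdWord d (n + 1) := by
  obtain ⟨u, hu⟩ := stdWord_last d (n + 1)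
  by_cases hn : Even n <;> simp [singWord, hu, hn, Nat.even_add_one]

/-- With `n = m - 1`: `v_n b = a s_{n+1}^{d_{n+2}-1} s_n` for odd `n` and
`v_n a = b s_{n+1}^{d_{n+2}-1} s_n` for even `n`. -/
theorem adjWord_append (d : ℕ → ℕ) (m : ℕ) :
    adjWord d (m + 1) ++ [if Even m then Letter.b else Letter.a] =
      (if Even m then Letter.a else Letter.b) ::
        (wpow (stdWord d (m + 1)) (d (m + 1) - 1) ++ stdWord d m) := by
  obtain ⟨u, hu⟩ := stdWord_last d m
  rw [adjWord, hu, ← List.append_assoc, List.dropLast_concat]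
  simp

/-- `∏_{j=-1}^{n-2} v_j`, that is `v_{-1} v_0 ⋯ v_{n-2}` (empty if `n = 0`). -/
def adjProd (d : ℕ → ℕ) (n : ℕ) : Word :=
  ((List.range n).map (fun i => adjWord d (i + 1))).flatten

/-- The word `U_{n,k} = (w_{n-1} v_{n-2})^k w_{n-1}`, `k ≥ 0`. -/
def palWord (d : ℕ → ℕ) (n k : ℕ) : Word :=
  wpow (singWord d (n + 1) ++ adjWord d n) k ++ singWord d (n + 1)

/-- `U_{n,k} = (w_{n-1} v_{n-2})^k w_{n-1}` in the free group, for every integer `k`;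
in particular `U_{n,-1} = (v_{n-2})⁻¹`. -/
def palFree (d : ℕ → ℕ) (n : ℕ) (k : ℤ) : FreeGroup Letter :=
  (toFree (singWord d (n + 1)) * toFree (adjWord d n)) ^ k * toFree (singWord d (n + 1))

theorem palFree_neg_one (d : ℕ → ℕ) (n : ℕ) : palFree d n (-1) = (toFree (adjWord d n))⁻¹ := by
  simp [palFree]

theorem palFree_natCast (d : ℕ → ℕ) (n k : ℕ) : palFree d n k = toFree (palWord d n k) := by
  simp [palFree, palWord, toFree, wpow, List.map_flatten, List.prod_flatten]

end Sturmian

open Sturmian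

namespace Sturmian

/-! ### Occurrences of finite words -/

/-! Let `σ` be the morphism a ↦ s_n, b ↦ s_nᵏ s_{n-1}, and let `l` be the last letter of s_n. The
proof writes `c_α = σ(y)` with `y` characteristic and locates the occurrences of U_{n,k} in terms of
`y`.

The maps γ ↦ γ/(1+γ) and γ ↦ 1-γ on slopes act on characteristic words as the morphisms a ↦ a, b ↦
ab (`isImage_shear_charWord`) and a ↔ b (`isImage_exchange_charWord`). On continued fractions they
raise the first quotient by one and turn [0;1,q,…] into [0;q+1,…]. Composing them along the
expansion gives `c_α = σ(y)` with `y` of slope [0; a_{n+1}+1-k, a_{n+2}, …] (`isImage_stdMorphism`);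
moreover `y` is the image of `x = c_{α_{n,-k}}` under a ↦ a, b ↦ ab.

U_{n,k} equals `l V`, where `σ(b)` is `V` followed by the other letter. It occurs in `σ(y)` exactly
at the last letters of the blocks `σ(a)`. This synchronisation property, `Marks`, is trivial for the
identity and survives both elementary morphisms, hence holds for `σ` (`marks_stdMorphism`).

The letters a of `y` are exactly the starts of the blocks a, ab coming from `x`. So a letter a of
`x` separates two consecutive occurrences of U_{n,k} by s_n, and a letter b by s_n s_nᵏ s_{n-1},
shifted by one letter. In the free group such a product is conjugated by `l`; the two gaps are then
U_{n,k} (U_{n,k-1})⁻¹ and U_{n,k} w_n, while the product of the v_j is s_n l⁻¹, the prefix before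
the first occurrence (`toFree_apply_stdMorphism_pre`). The cases k = 0 and k = d_{n+1}-1 give
w_{n-1} and v_{n-1}. -/

theorem occursAt_nil (c : ℕ → Letter) (m : ℕ) : OccursAt [] c m := fun i hi => by simp at hi

theorem occursAt_cons {l : Letter} {u : Word} {c : ℕ → Letter} {m : ℕ} :
    OccursAt (l :: u) c m ↔ c m = l ∧ OccursAt u c (m + 1) := by
  constructor
  · intro h
    refine ⟨h 0 (Nat.succ_pos _), fun i hi => ?_⟩
    have := h (i + 1) (by simpa using hi)
    simpa [Nat.add_assoc, Nat.add_comm 1] using this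
  · rintro ⟨h0, h⟩ i hi
    cases i with
    | zero => simpa using h0
    | succ i =>
      have := h i (by simpa using hi)
      simpa [Nat.add_assoc, Nat.add_comm 1] using this

theorem occursAt_append {u v : Word} {c : ℕ → Letter} {m : ℕ} :
    OccursAt (u ++ v) c m ↔ OccursAt u c m ∧ OccursAt v c (m + u.length) := by
  induction u generalizing m with
  | nil => simp [occursAt_nil]
  | cons l u ih =>
    simp only [List.cons_append, occursAt_cons, ih, List.length_cons, and_assoc]
    rw [Nat.add_right_comm, Nat.add_assoc]

theorem occursAt_singleton {l : Letter} {c : ℕ → Letter} {m : ℕ} :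
    OccursAt [l] c m ↔ c m = l := by
  simp [occursAt_cons, occursAt_nil]

theorem length_pre (c : ℕ → Letter) (m : ℕ) : (pre c m).length = m := by simp [pre]

theorem pre_succ (c : ℕ → Letter) (m : ℕ) : pre c (m + 1) = pre c m ++ [c m] := by
  simp [pre, List.range_succ]

theorem occursAt_pre (c : ℕ → Letter) (m : ℕ) : OccursAt (pre c m) c 0 := by
  intro i hi
  simp [pre]

theorem eq_pre_of_occursAt {c : ℕ → Letter} {u : Word} (h : OccursAt u c 0) :
    pre c u.length = u := by
  apply List.ext_getElem
  · simp [pre]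
  · intro i h1 h2
    have := h i h2
    simpa [pre] using this

/-! ### Morphisms and their action on infinite words -/

/-- The image of a finite word under the morphism `σ`. -/
abbrev apply (σ : Letter → Word) (u : Word) : Word := u.flatMap σ

/-- `c` is the image of the infinite word `x` under the morphism `σ`. -/
def IsImage (σ : Letter → Word) (x c : ℕ → Letter) : Prop :=
  ∀ i, OccursAt (apply σ (pre x i)) c 0

theorem apply_comp (σ τ : Letter → Word) (u : Word) :
    apply τ (apply σ u) = apply (fun l => apply τ (σ l)) u := by
  simp [apply, List.flatMap_assoc]

theorem apply_pre_succ (σ : Letter → Word) (x : ℕ → Letter) (i : ℕ) :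
    apply σ (pre x (i + 1)) = apply σ (pre x i) ++ σ (x i) := by
  simp [apply, pre_succ]

theorem IsImage.pre_eq {σ : Letter → Word} {x c : ℕ → Letter} (h : IsImage σ x c) (i : ℕ) :
    pre c (apply σ (pre x i)).length = apply σ (pre x i) :=
  eq_pre_of_occursAt (h i)

theorem IsImage.comp {σ τ : Letter → Word} {x y z : ℕ → Letter} (h : IsImage σ x y)
    (h' : IsImage τ y z) : IsImage (fun l => apply τ (σ l)) x z := by
  intro i
  rw [← apply_comp, ← h.pre_eq i]
  exact h' _

theorem IsImage.occursAt_block {σ : Letter → Word} {x c : ℕ → Letter} (h : IsImage σ x c)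
    (i : ℕ) : OccursAt (σ (x i)) c (apply σ (pre x i)).length := by
  have := h (i + 1)
  rw [apply_pre_succ, occursAt_append] at this
  simpa using this.2

theorem strictMono_length_apply_pre {σ : Letter → Word} (hσ : ∀ l, σ l ≠ [])
    (x : ℕ → Letter) : StrictMono (fun i => (apply σ (pre x i)).length) := by
  refine strictMono_nat_of_lt_succ fun i => ?_
  have := List.length_pos_iff.2 (hσ (x i))
  simp only [apply_pre_succ, List.length_append]
  omega

theorem pre_prefix (x : ℕ → Letter) {i j : ℕ} (h : i ≤ j) : pre x i <+: pre x j := by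
  induction j, h using Nat.le_induction with
  | base => exact List.prefix_rfl
  | succ j _ ih => exact ih.trans (pre_succ x j ▸ List.prefix_append _ _)

theorem apply_pre_prefix (σ : Letter → Word) (x : ℕ → Letter) {i j : ℕ} (h : i ≤ j) :
    apply σ (pre x i) <+: apply σ (pre x j) := by
  obtain ⟨t, ht⟩ := pre_prefix x h
  exact ⟨apply σ t, by rw [← ht]; simp [apply]⟩

theorem exists_isImage {σ : Letter → Word} (hσ : ∀ l, σ l ≠ []) (x : ℕ → Letter) :
    ∃ c, IsImage σ x c := by
  have hlen := strictMono_length_apply_pre hσ x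
  -- Images of letters are nonempty, so `n + 1` letters of `x` determine position `n`; the default
  -- letter is never used.
  refine ⟨fun n => (apply σ (pre x (n + 1))).getD n Letter.a, fun i m hm => ?_⟩
  have h1 : m < (apply σ (pre x (m + 1))).length := hlen.id_le (m + 1)
  simp only [Nat.zero_add]
  rw [List.getD_eq_getElem _ _ h1]
  rcases le_total i (m + 1) with h | h
  · exact ((apply_pre_prefix σ x h).getElem hm).symm
  · exact (apply_pre_prefix σ x h).getElem h1

theorem IsImage.unique {σ : Letter → Word} (hσ : ∀ l, σ l ≠ []) {x c c' : ℕ → Letter}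
    (h : IsImage σ x c) (h' : IsImage σ x c') : c = c' := by
  funext m
  have h1 : m < (apply σ (pre x (m + 1))).length :=
    (strictMono_length_apply_pre hσ x).id_le (m + 1)
  have e1 := h (m + 1) m h1
  have e2 := h' (m + 1) m h1
  simp only [Nat.zero_add] at e1 e2
  rw [e1, e2]

/-! ### The elementary morphisms -/

/-- The exchange of the two letters. -/
def Letter.swap : Letter → Letter
  | Letter.a => Letter.b
  | Letter.b => Letter.a

theorem Letter.swap_swap (l : Letter) : l.swap.swap = l := by cases l <;> rfl

theorem Letter.swap_injective : Function.Injective Letter.swap :=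
  Function.LeftInverse.injective Letter.swap_swap

/-- The morphism exchanging the two letters. -/
def exchange (l : Letter) : Word := [l.swap]

/-- The morphism `a ↦ a`, `b ↦ aᵏb`. -/
def shear (k : ℕ) : Letter → Word
  | Letter.a => [Letter.a]
  | Letter.b => List.replicate k Letter.a ++ [Letter.b]

theorem apply_exchange (u : Word) : apply exchange u = u.map Letter.swap := by
  induction u with
  | nil => rfl
  | cons l u ih => simpa [apply, exchange] using ih

theorem isImage_exchange {x c : ℕ → Letter} :
    IsImage exchange x c ↔ ∀ i, c i = (x i).swap := by
  constructor
  · intro h i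
    have := h.occursAt_block i
    rw [exchange, occursAt_singleton] at this
    simpa [apply_exchange, length_pre] using this
  · intro h i m hm
    simp only [apply_exchange, Nat.zero_add, h, List.getElem_map]
    simp [pre]

theorem apply_shear_replicate (k j : ℕ) :
    apply (shear k) (List.replicate j Letter.a) = List.replicate j Letter.a := by
  induction j with
  | zero => rfl
  | succ j ih => simpa [List.replicate_succ, apply, shear] using ih

theorem apply_shear_shear (j k : ℕ) : (fun l => apply (shear k) (shear j l)) = shear (j + k) := by
  funext l
  cases l
  · rfl
  · have := apply_shear_replicate k j
    simp only [apply] at this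
    simp only [shear, apply, List.flatMap_append, this, List.flatMap_singleton]
    rw [← List.append_assoc, List.replicate_append_replicate]

theorem shear_ne_nil (k : ℕ) (l : Letter) : shear k l ≠ [] := by cases l <;> simp [shear]

/-! ### Desubstitution -/

section Desubstitution

variable {x c : ℕ → Letter}

theorem IsImage.shear_start (h : IsImage (shear 1) x c) (t : ℕ) :
    c (apply (shear 1) (pre x t)).length = Letter.a := by
  have := h.occursAt_block t
  cases hx : x t <;> rw [hx] at this <;> exact (occursAt_cons.1 this).1

theorem length_shear_pre_succ_of_a {t : ℕ} (hx : x t = Letter.a) :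
    (apply (shear 1) (pre x (t + 1))).length = (apply (shear 1) (pre x t)).length + 1 := by
  rw [apply_pre_succ, hx]; simp [shear]

theorem length_shear_pre_succ_of_b {t : ℕ} (hx : x t = Letter.b) :
    (apply (shear 1) (pre x (t + 1))).length = (apply (shear 1) (pre x t)).length + 2 := by
  rw [apply_pre_succ, hx]; simp [shear]

theorem IsImage.shear_second (h : IsImage (shear 1) x c) {t : ℕ} (hx : x t = Letter.b) :
    c ((apply (shear 1) (pre x t)).length + 1) = Letter.b := by
  have := h.occursAt_block t
  rw [hx] at this
  exact (occursAt_cons.1 (occursAt_cons.1 this).2).1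

theorem exists_block_shear (x : ℕ → Letter) (s : ℕ) :
    ∃ t, s = (apply (shear 1) (pre x t)).length ∨
      (x t = Letter.b ∧ s = (apply (shear 1) (pre x t)).length + 1) := by
  induction s with
  | zero => exact ⟨0, Or.inl (by simp [pre, apply])⟩
  | succ s ih =>
    obtain ⟨t, h | ⟨hx, h⟩⟩ := ih
    · cases hx : x t with
      | a => exact ⟨t + 1, Or.inl (by rw [length_shear_pre_succ_of_a hx, h])⟩
      | b => exact ⟨t, Or.inr ⟨hx, by rw [h]⟩⟩
    · exact ⟨t + 1, Or.inl (by rw [length_shear_pre_succ_of_b hx, h])⟩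

theorem IsImage.shear_after_b (h : IsImage (shear 1) x c) {s : ℕ} (hs : c s = Letter.b) :
    c (s + 1) = Letter.a := by
  obtain ⟨t, e | ⟨hx, e⟩⟩ := exists_block_shear x s
  · rw [e, h.shear_start] at hs
    cases hs
  · have := h.shear_start (t + 1)
    rwa [length_shear_pre_succ_of_b hx, ← Nat.add_assoc _ 1 1, ← e] at this

theorem occursAt_apply_shear_append_a_head {V : Word} {m : ℕ}
    (h : OccursAt (apply (shear 1) V ++ [Letter.a]) c m) : c m = Letter.a := by
  cases V with
  | nil => exact (occursAt_cons.1 h).1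
  | cons l V =>
    cases l <;> exact (occursAt_cons.1 h).1

/-- Every block starts with a. The final a shows that the last block has ended: without it, an image
ending in a could match the beginning of a block ab. -/
theorem IsImage.occursAt_shear_iff (h : IsImage (shear 1) x c) (V : Word) (t : ℕ) :
    OccursAt (apply (shear 1) V ++ [Letter.a]) c (apply (shear 1) (pre x t)).length ↔
      OccursAt V x t := by
  induction V generalizing t with
  | nil => simpa [apply, occursAt_nil, occursAt_singleton, -List.length_flatMap] using h.shear_start t
  | cons l V ih =>
    cases l with
    | a =>
      have e : apply (shear 1) (Letter.a :: V) ++ [Letter.a] =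
          Letter.a :: (apply (shear 1) V ++ [Letter.a]) := rfl
      rw [e, occursAt_cons, occursAt_cons]
      cases hx : x t with
      | a => rw [← length_shear_pre_succ_of_a hx, ih, h.shear_start]
      | b =>
        refine iff_of_false (fun H => ?_) (fun H => by cases H.1)
        have := occursAt_apply_shear_append_a_head H.2
        rw [h.shear_second hx] at this
        cases this
    | b =>
      have e : apply (shear 1) (Letter.b :: V) ++ [Letter.a] =
          Letter.a :: Letter.b :: (apply (shear 1) V ++ [Letter.a]) := rfl
      rw [e, occursAt_cons, occursAt_cons, occursAt_cons]
      cases hx : x t with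
      | a =>
        refine iff_of_false (fun H => ?_) (fun H => by cases H.1)
        have := H.2.1
        rw [← length_shear_pre_succ_of_a hx, h.shear_start] at this
        cases this
      | b =>
        rw [Nat.add_assoc, ← length_shear_pre_succ_of_b hx, ih, h.shear_start, h.shear_second hx]
        simp

/-- The image of a letter ends in that same letter, so one letter on the left determines the
preceding block; the occurrence starts at the end of that block. -/
theorem IsImage.occursAt_cons_shear_iff (h : IsImage (shear 1) x c) (l : Letter) (V : Word)
    (s : ℕ) :
    OccursAt (l :: (apply (shear 1) V ++ [Letter.a])) c s ↔
      ∃ t, s + 1 = (apply (shear 1) (pre x (t + 1))).length ∧ OccursAt (l :: V) x t := by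
  constructor
  · intro H
    obtain ⟨H1, H2⟩ := occursAt_cons.1 H
    obtain ⟨t, e | ⟨hx, e⟩⟩ := exists_block_shear x s
    · have hl : l = Letter.a := by rw [← H1, e, h.shear_start]
      cases hx : x t with
      | a =>
        have e' : s + 1 = (apply (shear 1) (pre x (t + 1))).length := by
          rw [length_shear_pre_succ_of_a hx, e]
        rw [e', h.occursAt_shear_iff] at H2
        exact ⟨t, e', occursAt_cons.2 ⟨by rw [hx, hl], H2⟩⟩
      | b =>
        have := occursAt_apply_shear_append_a_head H2
        rw [e, h.shear_second hx] at this
        cases this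
    · have hl : l = Letter.b := by rw [← H1, e, h.shear_second hx]
      have e' : s + 1 = (apply (shear 1) (pre x (t + 1))).length := by
        rw [length_shear_pre_succ_of_b hx, e]
      rw [e', h.occursAt_shear_iff] at H2
      exact ⟨t, e', occursAt_cons.2 ⟨by rw [hx, hl], H2⟩⟩
  · rintro ⟨t, e, H⟩
    obtain ⟨H1, H2⟩ := occursAt_cons.1 H
    refine occursAt_cons.2 ⟨?_, by rw [e, h.occursAt_shear_iff]; exact H2⟩
    cases hx : x t with
    | a =>
      rw [length_shear_pre_succ_of_a hx] at e
      rw [← H1, hx, Nat.add_right_cancel e, h.shear_start]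
    | b =>
      rw [length_shear_pre_succ_of_b hx] at e
      have e' : s = (apply (shear 1) (pre x t)).length + 1 := by omega
      rw [← H1, hx, e', h.shear_second hx]

theorem IsImage.occursAt_exchange_iff (h : IsImage exchange x c) (u : Word) (s : ℕ) :
    OccursAt (apply exchange u) c s ↔ OccursAt u x s := by
  rw [isImage_exchange] at h
  simp only [OccursAt, apply_exchange, List.length_map, List.getElem_map, h,
    Letter.swap_injective.eq_iff]

end Desubstitution

/-! ### Marking words and their stability under the elementary morphisms -/

/-- The word `l V` marks the letter `a` under `σ`: here `l` is the first and last letter of `l V`,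
`σ b = V l'` with `l' ≠ l`, and the occurrences of `l V` in an image under `σ` begin with the
last letters of the images of the letters `a`. -/
structure Marks (σ : Letter → Word) (l : Letter) (V : Word) : Prop where
  ne_nil : ∀ l', σ l' ≠ []
  last : ∃ M, l :: V = M ++ [l]
  map_b : σ Letter.b = V ++ [l.swap]
  occursAt_iff : ∀ {x c : ℕ → Letter}, IsImage σ x c → ∀ s, (OccursAt (l :: V) c s ↔
    ∃ t, s + 1 = (apply σ (pre x (t + 1))).length ∧ x t = Letter.a)

theorem apply_singleton (u : Word) : apply (fun l => [l]) u = u := by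
  simp [apply]

theorem marks_id : Marks (fun l => [l]) Letter.a [] where
  ne_nil := by simp
  last := ⟨[], rfl⟩
  map_b := rfl
  occursAt_iff := by
    intro x c h s
    have hc : ∀ i, c i = x i := fun i => by
      have := h.occursAt_block i
      rw [apply_singleton, occursAt_singleton, length_pre] at this
      exact this
    simp only [occursAt_singleton, apply_singleton, length_pre, hc]
    constructor
    · intro h; exact ⟨s, rfl, h⟩
    · rintro ⟨t, e, h⟩; rwa [Nat.add_right_cancel e]

theorem ne_nil_comp {σ τ : Letter → Word} (hσ : ∀ l, σ l ≠ []) (hτ : ∀ l, τ l ≠ [])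
    (l : Letter) : apply τ (σ l) ≠ [] := by
  simp only [apply, ne_eq, List.flatMap_eq_nil_iff, not_forall]
  obtain ⟨y, hy⟩ := List.exists_mem_of_ne_nil _ (hσ l)
  exact ⟨y, hy, hτ y⟩

theorem IsImage.factor {σ τ : Letter → Word} (hσ : ∀ l, σ l ≠ []) (hτ : ∀ l, τ l ≠ [])
    {x c : ℕ → Letter} (h : IsImage (fun l => apply τ (σ l)) x c) :
    ∃ y, IsImage σ x y ∧ IsImage τ y c := by
  obtain ⟨y, hy⟩ := exists_isImage hσ x
  obtain ⟨z, hz⟩ := exists_isImage hτ y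
  have : z = c := (hy.comp hz).unique (ne_nil_comp hσ hτ) h
  exact ⟨y, hy, this ▸ hz⟩

/-- Occurrences of `l' V'` are pulled back by `τ` to occurrences of `l V`, and these by `σ` to
letters a. Last letters of blocks correspond to last letters of blocks, so the positions compose. -/
theorem Marks.comp {σ τ : Letter → Word} {l l' : Letter} {V V' : Word} (h : Marks σ l V)
    (hτ : ∀ l, τ l ≠ []) (hlast : ∃ M, l' :: V' = M ++ [l'])
    (hb : apply τ (V ++ [l.swap]) = V' ++ [l'.swap])
    (hocc : ∀ {x c : ℕ → Letter}, IsImage τ x c → ∀ s, (OccursAt (l' :: V') c s ↔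
      ∃ t, s + 1 = (apply τ (pre x (t + 1))).length ∧ OccursAt (l :: V) x t)) :
    Marks (fun i => apply τ (σ i)) l' V' where
  ne_nil := ne_nil_comp h.ne_nil hτ
  last := hlast
  map_b := by rw [h.map_b, hb]
  occursAt_iff := by
    intro x c hc s
    obtain ⟨y, hy, hy'⟩ := hc.factor h.ne_nil hτ
    rw [hocc hy']
    simp only [h.occursAt_iff hy]
    constructor
    · rintro ⟨t, e, t', e', h'⟩
      refine ⟨t', ?_, h'⟩
      rw [e, e', hy.pre_eq, apply_comp]
    · rintro ⟨t', e', h'⟩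
      -- The intermediate position is the last letter of the `σ`-block of index `t'`, so the length
      -- of the image must be a successor.
      have hpos : 0 < (apply σ (pre x (t' + 1))).length :=
        (Nat.zero_le _).trans_lt (strictMono_length_apply_pre h.ne_nil x (Nat.lt_succ_self t'))
      obtain ⟨t, ht⟩ := Nat.exists_eq_succ_of_ne_zero hpos.ne'
      refine ⟨t, ?_, t', ht.symm, h'⟩
      rw [e', ← apply_comp, ← hy.pre_eq, ht]

theorem Marks.exchange {σ : Letter → Word} {l : Letter} {V : Word} (h : Marks σ l V) :
    Marks (fun i => apply exchange (σ i)) l.swap (apply exchange V) := by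
  refine h.comp (fun l => by simp [Sturmian.exchange]) ?_ ?_ ?_
  · obtain ⟨M, hM⟩ := h.last
    refine ⟨apply Sturmian.exchange M, ?_⟩
    have := congrArg (List.map Letter.swap) hM
    simpa [apply_exchange] using this
  · simp [apply_exchange, Sturmian.exchange]
  · intro x c hc s
    have e : l.swap :: apply Sturmian.exchange V = apply Sturmian.exchange (l :: V) := rfl
    rw [e, hc.occursAt_exchange_iff]
    simp [apply_exchange, length_pre]

theorem Marks.shear_one {σ : Letter → Word} {l : Letter} {V : Word} (h : Marks σ l V) :
    ∃ V', Marks (fun i => apply (shear 1) (σ i)) l V' := by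
  cases l with
  | a =>
    refine ⟨apply (shear 1) V ++ [Letter.a], h.comp (shear_ne_nil 1)
      ⟨Letter.a :: apply (shear 1) V, rfl⟩ ?_ fun hc s => hc.occursAt_cons_shear_iff _ _ s⟩
    simp [apply, Letter.swap, shear]
  | b =>
    have hlast : ∃ M, Letter.b :: apply (shear 1) V = M ++ [Letter.b] := by
      obtain ⟨M, hM⟩ := h.last
      cases M with
      | nil =>
        obtain rfl : V = [] := by simpa using hM
        exact ⟨[], rfl⟩
      | cons m M =>
        obtain ⟨-, rfl⟩ : Letter.b = m ∧ V = M ++ [Letter.b] := by simpa using hM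
        exact ⟨Letter.b :: apply (shear 1) M ++ [Letter.a], by simp [apply, shear]⟩
    refine ⟨apply (shear 1) V, h.comp (shear_ne_nil 1) hlast ?_ fun hc s => ?_⟩
    · simp [apply, Letter.swap, shear]
    -- The a that closes the pattern may be dropped: the word ends in b, and in the image every b is
    -- followed by a.
    · rw [← hc.occursAt_cons_shear_iff, ← List.cons_append, occursAt_append, occursAt_singleton]
      refine ⟨fun H => ⟨H, ?_⟩, fun H => H.1⟩
      obtain ⟨M, hM⟩ := hlast
      rw [hM, occursAt_append, occursAt_singleton] at H
      rw [hM, List.length_append, List.length_singleton, ← Nat.add_assoc]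
      exact hc.shear_after_b H.2

theorem Marks.shear {σ : Letter → Word} {l : Letter} {V : Word} (h : Marks σ l V) (k : ℕ) :
    ∃ V', Marks (fun i => apply (shear k) (σ i)) l V' := by
  induction k with
  | zero =>
    have : Sturmian.shear 0 = fun l => [l] := by funext l; cases l <;> rfl
    exact ⟨V, by simpa only [this, apply_singleton] using h⟩
  | succ k ih =>
    obtain ⟨V', h'⟩ := ih
    obtain ⟨V'', h''⟩ := h'.shear_one
    refine ⟨V'', ?_⟩
    simpa only [apply_comp, apply_shear_shear] using h''

/-! ### Infinite continued fractions -/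

/-- The `N`-th convergent of `[0; a 1, a 2, …]`. -/
noncomputable def convergent : ℕ → (ℕ → ℤ) → ℝ
  | 0, _ => 0
  | N + 1, a => 1 / ((a 1 : ℝ) + convergent N (fun i => a (i + 1)))

theorem contFrac_convs' (a : ℕ → ℤ) (N : ℕ) : (contFrac a).convs' N = convergent N a := by
  rw [GenContFract.convs']
  change 0 + _ = _
  rw [zero_add]
  induction N generalizing a with
  | zero => rfl
  | succ N ih =>
    rw [GenContFract.convs'Aux_succ_some (p := ⟨1, (a 1 : ℝ)⟩) rfl, convergent, ← ih]
    rfl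

/-- All the partial quotients `a 1, a 2, …` are positive. -/
def PosQuotients (a : ℕ → ℤ) : Prop := ∀ i, 1 ≤ a (i + 1)

theorem PosQuotients.shift {a : ℕ → ℤ} (ha : PosQuotients a) :
    PosQuotients (fun i => a (i + 1)) := fun i => ha (i + 1)

theorem PosQuotients.one_le {a : ℕ → ℤ} (ha : PosQuotients a) : (1 : ℝ) ≤ a 1 := by
  exact_mod_cast ha 0

theorem convergent_mem {a : ℕ → ℤ} (ha : PosQuotients a) (N : ℕ) :
    0 ≤ convergent N a ∧ convergent N a ≤ 1 := by
  induction N generalizing a with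
  | zero => simp [convergent]
  | succ N ih =>
    obtain ⟨h0, -⟩ := ih ha.shift
    have h1 := ha.one_le
    refine ⟨by rw [convergent]; positivity, ?_⟩
    rw [convergent, div_le_one (by linarith)]
    linarith

/-- Two steps of the continued fraction contract by 1/4, since over a common denominator both
factors `p * (q + ·) + 1` are at least 2. -/
theorem abs_inv_add_inv_add_sub_le {p q x y : ℝ} (hp : 1 ≤ p) (hq : 1 ≤ q) (hx : 0 ≤ x)
    (hy : 0 ≤ y) :
    |1 / (p + 1 / (q + x)) - 1 / (p + 1 / (q + y))| ≤ |x - y| / 4 := by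
  have hx' : 0 < q + x := by linarith
  have hy' : 0 < q + y := by linarith
  have h1 : 2 ≤ p * (q + x) + 1 := by nlinarith
  have h2 : 2 ≤ p * (q + y) + 1 := by nlinarith
  have e : 1 / (p + 1 / (q + x)) - 1 / (p + 1 / (q + y)) =
      (x - y) / ((p * (q + x) + 1) * (p * (q + y) + 1)) := by
    field_simp
    ring
  rw [e, abs_div, abs_of_pos (a := _ * _) (by positivity)]
  exact div_le_div_of_nonneg_left (abs_nonneg _) (by norm_num) (by nlinarith)

theorem abs_convergent_sub_le (n : ℕ) {a : ℕ → ℤ} (ha : PosQuotients a) {M N : ℕ} (hM : n ≤ M)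
    (hN : n ≤ N) : |convergent M a - convergent N a| ≤ 2 * (1 / 2) ^ n := by
  induction n using Nat.twoStepInduction generalizing a M N with
  | zero =>
    have h1 := convergent_mem ha M
    have h2 := convergent_mem ha N
    rw [abs_le]; constructor <;> norm_num <;> linarith
  | one =>
    have h1 := convergent_mem ha M
    have h2 := convergent_mem ha N
    rw [abs_le]; constructor <;> norm_num <;> linarith
  | more n ih _ =>
    obtain ⟨M, rfl⟩ : ∃ k, M = k + 2 := ⟨M - 2, by omega⟩
    obtain ⟨N, rfl⟩ : ∃ k, N = k + 2 := ⟨N - 2, by omega⟩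
    have h := ih ha.shift.shift (M := M) (N := N) (by omega) (by omega)
    refine (abs_inv_add_inv_add_sub_le ha.one_le ha.shift.one_le
      (convergent_mem ha.shift.shift M).1 (convergent_mem ha.shift.shift N).1).trans ?_
    rw [pow_add]
    linarith

theorem tendsto_convergent {a : ℕ → ℤ} (ha : PosQuotients a) :
    Tendsto (fun N => convergent N a) atTop (𝓝 (cfVal a)) := by
  have hc : CauchySeq (fun N => convergent N a) := by
    refine cauchySeq_of_le_tendsto_0 (fun n => 2 * (1 / 2 : ℝ) ^ n)
      (fun M N n hM hN => abs_convergent_sub_le n ha hM hN) ?_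
    simpa using (tendsto_pow_atTop_nhds_zero_of_lt_one (r := (1 / 2 : ℝ)) (by norm_num)
      (by norm_num)).const_mul 2
  obtain ⟨x, hx⟩ := cauchySeq_tendsto_of_complete hc
  have : cfVal a = x := by
    simp only [cfVal, contFrac_convs']
    exact hx.limUnder_eq
  rwa [this]

theorem cfVal_nonneg {a : ℕ → ℤ} (ha : PosQuotients a) : 0 ≤ cfVal a :=
  ge_of_tendsto' (tendsto_convergent ha) fun N => (convergent_mem ha N).1

theorem cfVal_eq {a : ℕ → ℤ} (ha : PosQuotients a) :
    cfVal a = 1 / ((a 1 : ℝ) + cfVal (fun i => a (i + 1))) := by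
  have h1 := (tendsto_add_atTop_iff_nat 1).2 (tendsto_convergent ha)
  have hne : (a 1 : ℝ) + cfVal (fun i => a (i + 1)) ≠ 0 := by
    have := ha.one_le
    have := cfVal_nonneg ha.shift
    positivity
  have h2 := (tendsto_const_nhds (x := (1 : ℝ))).div
    ((tendsto_convergent ha.shift).const_add (a 1 : ℝ)) hne
  exact tendsto_nhds_unique h1 h2

theorem cfVal_pos {a : ℕ → ℤ} (ha : PosQuotients a) : 0 < cfVal a := by
  rw [cfVal_eq ha]
  have := ha.one_le
  have := cfVal_nonneg ha.shift
  positivity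

theorem cfVal_lt_one {a : ℕ → ℤ} (ha : PosQuotients a) : cfVal a < 1 := by
  have h1 := ha.one_le
  have h2 := cfVal_pos ha.shift
  rw [cfVal_eq ha, div_lt_one (by linarith)]
  linarith

/-- Infinite descent, by the Euclidean algorithm: a value in (0,1) with denominator `q` would have a
tail with the smaller denominator `p`. -/
theorem cfVal_mul_ne {a : ℕ → ℤ} (ha : PosQuotients a) (q : ℕ) (hq : 0 < q) (p : ℤ) :
    cfVal a * q ≠ p := by
  induction q using Nat.strong_induction_on generalizing a p with
  | _ q ih =>
    intro h
    have hq' : (0 : ℝ) < q := by exact_mod_cast hq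
    have h0 := cfVal_pos ha
    have h1 := cfVal_lt_one ha
    have hp0 : (0 : ℝ) < p := by rw [← h]; positivity
    have hp1 : (p : ℝ) < q := by rw [← h]; nlinarith
    lift p to ℕ using by exact_mod_cast hp0.le
    have hpos : 0 < p := by exact_mod_cast hp0
    refine ih p (by exact_mod_cast hp1) ha.shift hpos (q - a 1 * p) ?_
    have h2 := cfVal_pos ha.shift
    have h3 := ha.one_le
    rw [cfVal_eq ha, div_mul_eq_mul_div, one_mul, div_eq_iff (by positivity)] at h
    push_cast at h ⊢
    linarith

theorem irrational_cfVal {a : ℕ → ℤ} (ha : PosQuotients a) : Irrational (cfVal a) := by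
  rintro ⟨r, hr⟩
  refine cfVal_mul_ne ha r.den r.pos r.num ?_
  rw [← hr]
  exact_mod_cast Rat.mul_den_eq_num r

/-! ### Tails with a modified first quotient -/

/-- The number `[0; j, d (n+2), d (n+3), …]`. -/
noncomputable def tailCf (d : ℕ → ℕ) (n : ℕ) (j : ℤ) : ℝ :=
  cfVal (fun i => if i = 1 then j else (d (n + i) : ℤ))

theorem cfVal_congr {a b : ℕ → ℤ} (h : ∀ i, a (i + 1) = b (i + 1)) : cfVal a = cfVal b := by
  simp [cfVal, contFrac, h]

theorem posQuotients_tail {d : ℕ → ℕ} (hd : ∀ i, 1 ≤ i → 1 ≤ d i) (n : ℕ) {j : ℤ}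
    (hj : 1 ≤ j) : PosQuotients (fun i => if i = 1 then j else (d (n + i) : ℤ)) := by
  intro i
  dsimp only
  split_ifs
  · exact hj
  · exact_mod_cast hd _ (by omega)

theorem tailCf_eq {d : ℕ → ℕ} (hd : ∀ i, 1 ≤ i → 1 ≤ d i) (n : ℕ) {j : ℤ} (hj : 1 ≤ j) :
    tailCf d n j = 1 / ((j : ℝ) + tailCf d (n + 1) (d (n + 2))) := by
  rw [tailCf, cfVal_eq (posQuotients_tail hd n hj), tailCf]
  congr 2
  refine cfVal_congr fun i => ?_
  cases i with
  | zero => simp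
  | succ i => simp [show n + (i + 1 + 1 + 1) = n + 1 + (i + 1 + 1) by omega]

theorem tailCf_pos {d : ℕ → ℕ} (hd : ∀ i, 1 ≤ i → 1 ≤ d i) (n : ℕ) {j : ℤ} (hj : 1 ≤ j) :
    0 < tailCf d n j := cfVal_pos (posQuotients_tail hd n hj)

theorem tailCf_lt_one {d : ℕ → ℕ} (hd : ∀ i, 1 ≤ i → 1 ≤ d i) (n : ℕ) {j : ℤ} (hj : 1 ≤ j) :
    tailCf d n j < 1 := cfVal_lt_one (posQuotients_tail hd n hj)

theorem irrational_tailCf {d : ℕ → ℕ} (hd : ∀ i, 1 ≤ i → 1 ≤ d i) (n : ℕ) {j : ℤ}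
    (hj : 1 ≤ j) : Irrational (tailCf d n j) := irrational_cfVal (posQuotients_tail hd n hj)

theorem tailCf_add_one {d : ℕ → ℕ} (hd : ∀ i, 1 ≤ i → 1 ≤ d i) (n : ℕ) {j : ℤ} (hj : 1 ≤ j) :
    tailCf d n (j + 1) = tailCf d n j / (1 + tailCf d n j) := by
  have hj' : (1 : ℝ) ≤ j := by exact_mod_cast hj
  have hpos := tailCf_pos hd (n + 1) (j := d (n + 2)) (by exact_mod_cast hd _ (by omega))
  rw [tailCf_eq hd n hj, tailCf_eq hd n (by omega)]
  push_cast
  field_simp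
  ring

theorem tailCf_one {d : ℕ → ℕ} (hd : ∀ i, 1 ≤ i → 1 ≤ d i) (n : ℕ) :
    tailCf d n 1 = 1 - tailCf d (n + 1) (d (n + 2) + 1) := by
  have hd' : (1 : ℤ) ≤ d (n + 2) := by exact_mod_cast hd _ (by omega)
  have hpos := tailCf_pos hd (n + 1) hd'
  rw [tailCf_add_one hd _ hd', tailCf_eq hd n le_rfl]
  push_cast
  field_simp
  ring

/-! ### Characteristic words under the elementary morphisms -/

theorem charWord_eq_a_iff (γ : ℝ) (i : ℕ) :
    charWord γ i = Letter.a ↔ ⌊((i : ℝ) + 2) * γ⌋ = ⌊((i : ℝ) + 1) * γ⌋ := by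
  have e : ((i + 1 : ℕ) : ℝ) + 1 = (i : ℝ) + 2 := by push_cast; ring
  rw [charWord, sturmianWord, e]
  simp [sub_eq_zero]

theorem charWord_eq_b_iff (γ : ℝ) (i : ℕ) :
    charWord γ i = Letter.b ↔ ⌊((i : ℝ) + 2) * γ⌋ ≠ ⌊((i : ℝ) + 1) * γ⌋ := by
  rw [ne_eq, ← charWord_eq_a_iff]
  cases charWord γ i <;> simp

theorem floor_succ_mul {γ : ℝ} (h0 : 0 < γ) (h1 : γ < 1) (i : ℕ) :
    ⌊((i : ℝ) + 2) * γ⌋ = ⌊((i : ℝ) + 1) * γ⌋ ∨ ⌊((i : ℝ) + 2) * γ⌋ = ⌊((i : ℝ) + 1) * γ⌋ + 1 := by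
  have e : ((i : ℝ) + 2) * γ = ((i : ℝ) + 1) * γ + γ := by ring
  have h2 : ⌊((i : ℝ) + 1) * γ⌋ ≤ ⌊((i : ℝ) + 2) * γ⌋ := Int.floor_mono (by linarith)
  have h3 : ⌊((i : ℝ) + 2) * γ⌋ < ⌊((i : ℝ) + 1) * γ⌋ + 2 := by
    rw [Int.floor_lt]
    have := Int.lt_floor_add_one (((i : ℝ) + 1) * γ)
    push_cast
    linarith
  omega

theorem isImage_exchange_charWord {γ : ℝ} (h0 : 0 < γ) (h1 : γ < 1) (hγ : Irrational γ) :
    IsImage exchange (charWord γ) (charWord (1 - γ)) := by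
  rw [isImage_exchange]
  intro i
  -- Irrationality keeps `m * γ` off the integers, so the floors of `m * γ` and `m * (1 - γ)` add up
  -- to `m - 1`.
  have key : ∀ m : ℕ, 0 < m → ⌊(m : ℝ) * (1 - γ)⌋ = m - ⌊(m : ℝ) * γ⌋ - 1 := by
    intro m hm
    have hirr : (m : ℝ) * γ ≠ ⌊(m : ℝ) * γ⌋ := (hγ.natCast_mul hm.ne').ne_int _
    have h2 := lt_of_le_of_ne (Int.floor_le ((m : ℝ) * γ)) hirr.symm
    have h3 := Int.lt_floor_add_one ((m : ℝ) * γ)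
    rw [Int.floor_eq_iff]
    push_cast
    constructor <;> linarith
  have k1 := key (i + 1) (by omega)
  have k2 := key (i + 2) (by omega)
  push_cast at k1 k2
  have h := floor_succ_mul h0 h1 i
  cases hx : charWord γ i with
  | a =>
    rw [charWord_eq_a_iff] at hx
    rw [Letter.swap, charWord_eq_b_iff]
    omega
  | b =>
    rw [charWord_eq_b_iff] at hx
    rw [Letter.swap, charWord_eq_a_iff]
    omega

theorem charWord_div_one_add {γ : ℝ} (h0 : 0 < γ) (i : ℕ) {N : ℕ}
    (hN : ⌊((i : ℝ) + 1) * γ⌋ = N) : charWord (γ / (1 + γ)) (i + N) = Letter.a := by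
  rw [charWord_eq_a_iff]
  obtain ⟨h1, h2⟩ := Int.floor_eq_iff.1 hN
  push_cast at h1 h2 ⊢
  have e1 : ⌊((i : ℝ) + N + 1) * (γ / (1 + γ))⌋ = N := by
    rw [Int.floor_eq_iff, ← mul_div_assoc, le_div_iff₀ (by linarith), div_lt_iff₀ (by linarith)]
    push_cast
    constructor <;> linarith
  have e2 : ⌊((i : ℝ) + N + 2) * (γ / (1 + γ))⌋ = N := by
    rw [Int.floor_eq_iff, ← mul_div_assoc, le_div_iff₀ (by linarith), div_lt_iff₀ (by linarith)]
    push_cast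
    constructor <;> linarith
  rw [e1, e2]

theorem charWord_div_one_add_succ {γ : ℝ} (h0 : 0 < γ) (i : ℕ) {N : ℕ}
    (hN : ⌊((i : ℝ) + 1) * γ⌋ = N) (hN' : ⌊((i : ℝ) + 2) * γ⌋ = N + 1) :
    charWord (γ / (1 + γ)) (i + N + 1) = Letter.b := by
  rw [charWord_eq_b_iff]
  obtain ⟨h1, h2⟩ := Int.floor_eq_iff.1 hN
  obtain ⟨h3, h4⟩ := Int.floor_eq_iff.1 hN'
  push_cast at h1 h2 h3 h4 ⊢
  refine (lt_of_lt_of_le (b := (N : ℤ) + 1) ?_ ?_).ne'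
  · rw [Int.floor_lt, ← mul_div_assoc, div_lt_iff₀ (by linarith)]
    push_cast
    linarith
  · rw [Int.le_floor, ← mul_div_assoc, le_div_iff₀ (by linarith)]
    push_cast
    linarith

/-- The first `i` letters of `c_γ` contain ⌊(i+1)γ⌋ letters b, because ⌊γ⌋ = 0. Hence block `i`
starts at `i + ⌊(i+1)γ⌋`, where the floors for γ/(1+γ) can be evaluated directly. -/
theorem isImage_shear_charWord {γ : ℝ} (h0 : 0 < γ) (h1 : γ < 1) :
    IsImage (shear 1) (charWord γ) (charWord (γ / (1 + γ))) := by
  suffices H : ∀ i : ℕ, (((apply (shear 1) (pre (charWord γ) i)).length : ℕ) : ℤ) =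
      i + ⌊((i : ℝ) + 1) * γ⌋ ∧
      OccursAt (apply (shear 1) (pre (charWord γ) i)) (charWord (γ / (1 + γ))) 0 from
    fun i => (H i).2
  intro i
  induction i with
  | zero =>
    have : ⌊γ⌋ = 0 := Int.floor_eq_zero_iff.2 ⟨h0.le, h1⟩
    refine ⟨?_, fun i hi => ?_⟩
    · simp [pre, this]
    · simp [pre] at hi
  | succ i ih =>
    obtain ⟨hl, ho⟩ := ih
    have hfl : 0 ≤ ⌊((i : ℝ) + 1) * γ⌋ := Int.floor_nonneg.2 (by positivity)
    obtain ⟨N, hN⟩ := Int.eq_ofNat_of_zero_le hfl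
    have hlen : (apply (shear 1) (pre (charWord γ) i)).length = i + N := by omega
    have e : ((i + 1 : ℕ) : ℝ) + 1 = (i : ℝ) + 2 := by push_cast; ring
    have hsucc := floor_succ_mul h0 h1 i
    rw [apply_pre_succ, occursAt_append, Nat.zero_add, hlen, e]
    cases hx : charWord γ i with
    | a =>
      rw [charWord_eq_a_iff] at hx
      refine ⟨?_, ho, occursAt_cons.2 ⟨charWord_div_one_add h0 i hN, occursAt_nil _ _⟩⟩
      rw [List.length_append, hlen, hx, hN]
      simp only [shear, List.length_singleton]
      push_cast
      ring
    | b =>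
      rw [charWord_eq_b_iff] at hx
      have hx' : ⌊((i : ℝ) + 2) * γ⌋ = N + 1 := by omega
      refine ⟨?_, ho, occursAt_cons.2 ⟨charWord_div_one_add h0 i hN, occursAt_cons.2
        ⟨charWord_div_one_add_succ h0 i hN hx', occursAt_nil _ _⟩⟩⟩
      rw [List.length_append, hlen, hx']
      simp only [shear, List.length_append, List.length_replicate, List.length_singleton]
      push_cast
      ring

/-! ### The standard words and the words `U_{n,k}` -/

theorem wpow_zero (u : Word) : wpow u 0 = [] := rfl

theorem wpow_succ (u : Word) (k : ℕ) : wpow u (k + 1) = u ++ wpow u k := by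
  simp [wpow, List.replicate_succ]

theorem apply_wpow (σ : Letter → Word) (u : Word) (k : ℕ) :
    apply σ (wpow u k) = wpow (apply σ u) k := by
  induction k with
  | zero => rfl
  | succ k ih => rw [wpow_succ, wpow_succ, ← ih]; simp [apply]

theorem wpow_singleton (l : Letter) (k : ℕ) : wpow [l] k = List.replicate k l := by
  induction k with
  | zero => rfl
  | succ k ih => rw [wpow_succ, ih]; rfl

theorem wpow_append_singleton {u v : Word} {l : Letter} (h : u ++ [l] = l :: v) (k : ℕ) :
    wpow u k ++ [l] = l :: wpow v k := by
  induction k with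
  | zero => rfl
  | succ k ih => rw [wpow_succ, wpow_succ, List.append_assoc, ih, List.append_cons, h]; simp

theorem toFree_append (u v : Word) : toFree (u ++ v) = toFree u * toFree v := by
  simp [toFree]

theorem toFree_cons (l : Letter) (u : Word) : toFree (l :: u) = FreeGroup.of l * toFree u := by
  simp [toFree]

theorem toFree_nil : toFree [] = 1 := rfl

theorem toFree_wpow (u : Word) (k : ℕ) : toFree (wpow u k) = toFree u ^ k := by
  induction k with
  | zero => rfl
  | succ k ih => rw [wpow_succ, toFree_append, ih, pow_succ']

theorem stdWord_shift (d : ℕ → ℕ) (m : ℕ) :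
    apply (shear (d 1)) (apply exchange (stdWord (fun i => d (i + 1)) m)) = stdWord d (m + 1) := by
  induction m using Nat.twoStepInduction with
  | zero => rfl
  | one => simp [stdWord, apply, exchange, Letter.swap, shear, wpow_singleton]
  | more m ih1 ih2 =>
    rw [stdWord, stdWord, ← ih1, ← ih2, ← apply_wpow, ← apply_wpow]
    simp [apply, List.flatMap_append]

/-- The morphism `a ↦ s_n`, `b ↦ s_nᵏ s_{n-1}`. -/
def stdMorphism (d : ℕ → ℕ) (n k : ℕ) : Letter → Word
  | Letter.a => stdWord d (n + 1)
  | Letter.b => wpow (stdWord d (n + 1)) k ++ stdWord d n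

theorem stdMorphism_zero (d : ℕ → ℕ) (k : ℕ) : stdMorphism d 0 k = shear k := by
  funext l
  cases l <;> simp [stdMorphism, shear, stdWord, wpow_singleton]

/-- Peels off the outermost elementary morphisms, which involve `d 1`. This suits `Marks`, whose
stability lemmas compose on the outside; `stdMorphism_succ` peels off the innermost ones, as needed
to follow the slope of the preimage. -/
theorem stdMorphism_shift (d : ℕ → ℕ) (n k : ℕ) :
    (fun l => apply (shear (d 1)) (apply exchange (stdMorphism (fun i => d (i + 1)) n k l))) =
      stdMorphism d (n + 1) k := by
  funext l
  cases l with
  | a => exact stdWord_shift d (n + 1)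
  | b =>
    simp only [stdMorphism]
    rw [← stdWord_shift d (n + 1), ← stdWord_shift d n, ← apply_wpow, ← apply_wpow]
    simp [apply, List.flatMap_append]

theorem apply_stdMorphism_replicate (d : ℕ → ℕ) (n k : ℕ) :
    apply (stdMorphism d n 0) (List.replicate k Letter.a) = wpow (stdWord d (n + 1)) k := by
  rw [← wpow_singleton, apply_wpow]
  simp [apply, stdMorphism]

theorem stdMorphism_shear (d : ℕ → ℕ) (n k : ℕ) :
    (fun l => apply (stdMorphism d n 0) (shear k l)) = stdMorphism d n k := by
  funext l
  cases l with
  | a => simp [shear, apply, stdMorphism]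
  | b =>
    have := apply_stdMorphism_replicate d n k
    simp only [apply] at this
    simp [shear, apply, List.flatMap_append, this, stdMorphism, wpow_zero]

theorem stdMorphism_succ (d : ℕ → ℕ) (n : ℕ) :
    (fun l => apply (stdMorphism d n 0) (apply (shear (d (n + 1))) (exchange l))) =
      stdMorphism d (n + 1) 0 := by
  funext l
  rw [apply_comp, stdMorphism_shear]
  cases l with
  | a => simp [apply, exchange, Letter.swap, stdMorphism, stdWord]
  | b => simp [apply, exchange, Letter.swap, stdMorphism, wpow_zero]

theorem exists_marks_stdMorphism (d : ℕ → ℕ) (n k : ℕ) :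
    ∃ l V, Marks (stdMorphism d n k) l V := by
  induction n generalizing d with
  | zero =>
    obtain ⟨V, h⟩ := marks_id.shear k
    refine ⟨Letter.a, V, ?_⟩
    rw [stdMorphism_zero]
    simpa [apply] using h
  | succ n ih =>
    obtain ⟨l, V, h⟩ := ih (fun i => d (i + 1))
    obtain ⟨V', h'⟩ := h.exchange.shear (d 1)
    exact ⟨_, V', stdMorphism_shift d n k ▸ h'⟩

/-! ### Singular and adjoining words in terms of standard words -/

/-- The last letter of `s_n`. -/
def lastLetter (n : ℕ) : Letter := if Even n then Letter.a else Letter.b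

theorem swap_lastLetter (n : ℕ) : (lastLetter n).swap = if Even n then Letter.b else Letter.a := by
  unfold lastLetter
  split_ifs <;> rfl

theorem lastLetter_succ (n : ℕ) : lastLetter (n + 1) = (lastLetter n).swap := by
  rw [swap_lastLetter]
  unfold lastLetter
  by_cases h : Even n <;> simp [h, Nat.even_add_one]

theorem singWord_append_lastLetter (d : ℕ → ℕ) (n : ℕ) :
    singWord d (n + 2) ++ [lastLetter n] = (lastLetter n).swap :: stdWord d (n + 1) := by
  rw [swap_lastLetter]
  exact singWord_append d n

theorem adjWord_append_lastLetter (d : ℕ → ℕ) (n : ℕ) :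
    adjWord d (n + 1) ++ [(lastLetter n).swap] =
      lastLetter n :: (wpow (stdWord d (n + 1)) (d (n + 1) - 1) ++ stdWord d n) := by
  rw [swap_lastLetter]
  exact adjWord_append d n

theorem stdWord_append_wpow {d : ℕ → ℕ} (hd : ∀ i, 1 ≤ i → 1 ≤ d i) (n : ℕ) :
    stdWord d (n + 1) ++ (wpow (stdWord d (n + 1)) (d (n + 1) - 1) ++ stdWord d n) =
      stdWord d (n + 2) := by
  rw [← List.append_assoc, ← wpow_succ, Nat.sub_add_cancel (hd _ (by omega)), stdWord]

theorem singWord_adjWord_append {d : ℕ → ℕ} (hd : ∀ i, 1 ≤ i → 1 ≤ d i) (n : ℕ) :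
    (singWord d (n + 2) ++ adjWord d (n + 1)) ++ [lastLetter (n + 1)] =
      lastLetter (n + 1) :: stdWord d (n + 2) := by
  rw [lastLetter_succ, List.append_assoc, adjWord_append_lastLetter, List.append_cons,
    singWord_append_lastLetter, List.cons_append, stdWord_append_wpow hd]

/-- The word w_n v_{n-1} is conjugate to s_{n+1} by one letter, which can therefore be moved through
the whole power. -/
theorem palWord_append {d : ℕ → ℕ} (hd : ∀ i, 1 ≤ i → 1 ≤ d i) (n k : ℕ) :
    palWord d (n + 1) k ++ [(lastLetter (n + 1)).swap] =
      lastLetter (n + 1) :: (wpow (stdWord d (n + 2)) k ++ stdWord d (n + 1)) := by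
  rw [palWord, List.append_assoc, lastLetter_succ, Letter.swap_swap, singWord_append_lastLetter,
    ← lastLetter_succ, List.append_cons, wpow_append_singleton (singWord_adjWord_append hd n)]
  rfl

theorem adjWord_eq_palWord {d : ℕ → ℕ} (hd : ∀ i, 1 ≤ i → 1 ≤ d i) (n : ℕ) :
    adjWord d (n + 2) = palWord d (n + 1) (d (n + 2) - 1) := by
  have h := adjWord_append_lastLetter d (n + 1)
  rw [← palWord_append hd] at h
  exact List.append_cancel_right h

/-- Telescoping: the letter missing at the end of one factor is the one with which the next factor
begins, and s_n (s_n^{d-1} s_{n-1}) = s_{n+1} for d = d_{n+1}. -/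
theorem adjProd_append {d : ℕ → ℕ} (hd : ∀ i, 1 ≤ i → 1 ≤ d i) (n : ℕ) :
    adjProd d n ++ [lastLetter n] = stdWord d (n + 1) := by
  induction n with
  | zero => rfl
  | succ n ih =>
    have e : adjProd d (n + 1) = adjProd d n ++ adjWord d (n + 1) := by
      simp [adjProd, List.range_succ]
    rw [e, lastLetter_succ, List.append_assoc, adjWord_append_lastLetter, List.append_cons, ih,
      stdWord_append_wpow hd]

theorem marks_stdMorphism {d : ℕ → ℕ} (hd : ∀ i, 1 ≤ i → 1 ≤ d i) (n k : ℕ) :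
    ∃ V, palWord d (n + 1) k = lastLetter (n + 1) :: V ∧
      Marks (stdMorphism d (n + 1) k) (lastLetter (n + 1)) V := by
  obtain ⟨l, V, h⟩ := exists_marks_stdMorphism d (n + 1) k
  obtain ⟨u, hu⟩ := stdWord_last d (n + 1)
  rw [← swap_lastLetter] at hu
  have hb : (wpow (stdWord d (n + 2)) k ++ u) ++ [(lastLetter (n + 1)).swap] = V ++ [l.swap] := by
    rw [← h.map_b, List.append_assoc, ← hu]
    rfl
  obtain ⟨hV, hl⟩ := List.append_inj' hb rfl
  -- The inductively obtained pair `l`, `V` is forced: the image of b is `V` followed by the other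
  -- letter, and it ends in the last letter of s_n.
  obtain rfl : lastLetter (n + 1) = l := Letter.swap_injective (by simpa using hl)
  refine ⟨V, ?_, h⟩
  have hp := palWord_append hd n k
  rw [hu, ← List.append_assoc, hV] at hp
  exact List.append_cancel_right hp

/-! ### Characteristic words as images of characteristic words -/

theorem isImage_shear_zero (x : ℕ → Letter) : IsImage (shear 0) x x := by
  have : shear 0 = fun l => [l] := by funext l; cases l <;> rfl
  intro i
  rw [this, apply_singleton]
  exact occursAt_pre x i

theorem isImage_shear_tailCf {d : ℕ → ℕ} (hd : ∀ i, 1 ≤ i → 1 ≤ d i) (n : ℕ) {j : ℤ}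
    (hj : 1 ≤ j) (k : ℕ) :
    IsImage (shear k) (charWord (tailCf d n j)) (charWord (tailCf d n (j + k))) := by
  induction k with
  | zero => simpa using isImage_shear_zero _
  | succ k ih =>
    have hjk : (1 : ℤ) ≤ j + k := by omega
    have h := isImage_shear_charWord (tailCf_pos hd n hjk) (tailCf_lt_one hd n hjk)
    rw [← tailCf_add_one hd n hjk] at h
    have h' := ih.comp h
    rw [apply_shear_shear] at h'
    simpa [add_assoc] using h'

theorem isImage_exchange_tailCf {d : ℕ → ℕ} (hd : ∀ i, 1 ≤ i → 1 ≤ d i) (n : ℕ) :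
    IsImage exchange (charWord (tailCf d (n + 1) (d (n + 2) + 1))) (charWord (tailCf d n 1)) := by
  have hj : (1 : ℤ) ≤ d (n + 2) + 1 := by omega
  rw [tailCf_one hd]
  exact isImage_exchange_charWord (tailCf_pos hd _ hj) (tailCf_lt_one hd _ hj)
    (irrational_tailCf hd _ hj)

theorem isImage_stdMorphism_zero {d : ℕ → ℕ} (hd : ∀ i, 1 ≤ i → 1 ≤ d i) (n : ℕ) :
    IsImage (stdMorphism d n 0) (charWord (tailCf d n (d (n + 1) + 1)))
      (charWord (tailCf d 0 (d 1 + 1))) := by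
  induction n with
  | zero => rw [stdMorphism_zero]; exact isImage_shear_zero _
  | succ n ih =>
    have h := isImage_shear_tailCf hd n (le_refl 1) (d (n + 1))
    rw [add_comm (1 : ℤ)] at h
    have h' := ((isImage_exchange_tailCf hd n).comp h).comp ih
    rwa [stdMorphism_succ] at h'

/-- Absorbing `k` factors a ↦ a, b ↦ ab into the morphism lowers the first quotient of the preimage
by `k`. -/
theorem isImage_stdMorphism {d : ℕ → ℕ} (hd : ∀ i, 1 ≤ i → 1 ≤ d i) (n : ℕ) {k : ℕ}
    (hk : k ≤ d (n + 1)) :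
    IsImage (stdMorphism d n k) (charWord (tailCf d n (d (n + 1) + 1 - k)))
      (charWord (tailCf d 0 (d 1 + 1))) := by
  have h := (isImage_shear_tailCf hd n (j := d (n + 1) + 1 - k) (by omega) k).comp
    (by simpa using isImage_stdMorphism_zero hd n)
  rwa [stdMorphism_shear] at h

theorem cfVal_quotients (d : ℕ → ℕ) : cfVal (quotients d) = tailCf d 0 (d 1 + 1) := by
  refine cfVal_congr fun i => ?_
  cases i with
  | zero => simp [quotients, add_comm]
  | succ i => simp [quotients]

theorem cfShift_quotients (d : ℕ → ℕ) (n : ℕ) (k : ℤ) :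
    cfShift (quotients d) (n + 1) k = tailCf d (n + 1) (d (n + 2) + k) := by
  refine cfVal_congr fun i => ?_
  cases i with
  | zero => simp [quotients]
  | succ i =>
    have : n + 1 + (i + 1 + 1) ≠ 1 := by omega
    simp [quotients, this]

/-! ### Occurrences of `U_{n,k}` -/

theorem IsImage.eq_a_iff_shear {x y : ℕ → Letter} (h : IsImage (shear 1) x y) (t : ℕ) :
    y t = Letter.a ↔ ∃ i, (apply (shear 1) (pre x i)).length = t := by
  constructor
  · intro ht
    obtain ⟨i, e | ⟨hx, e⟩⟩ := exists_block_shear x t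
    · exact ⟨i, e.symm⟩
    · rw [e, h.shear_second hx] at ht
      cases ht
  · rintro ⟨i, rfl⟩
    exact h.shear_start i

/-! ### Gaps between occurrences, in the free group -/

theorem toFree_singWord (d : ℕ → ℕ) (n : ℕ) :
    toFree (singWord d (n + 2)) = FreeGroup.of (lastLetter n).swap * toFree (stdWord d (n + 1)) *
      (FreeGroup.of (lastLetter n))⁻¹ := by
  have h := congrArg toFree (singWord_append_lastLetter d n)
  rw [toFree_append, toFree_cons, toFree_cons, toFree_nil, mul_one] at h
  rw [← h, mul_inv_cancel_right]

theorem toFree_singWord_mul_adjWord {d : ℕ → ℕ} (hd : ∀ i, 1 ≤ i → 1 ≤ d i) (n : ℕ) :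
    toFree (singWord d (n + 2)) * toFree (adjWord d (n + 1)) =
      FreeGroup.of (lastLetter (n + 1)) * toFree (stdWord d (n + 2)) *
        (FreeGroup.of (lastLetter (n + 1)))⁻¹ := by
  have h := congrArg toFree (singWord_adjWord_append hd n)
  rw [toFree_append, toFree_append, toFree_cons, toFree_cons, toFree_nil, mul_one] at h
  rw [← h, mul_inv_cancel_right]

theorem toFree_palWord {d : ℕ → ℕ} (hd : ∀ i, 1 ≤ i → 1 ≤ d i) (n k : ℕ) :
    toFree (palWord d (n + 1) k) = FreeGroup.of (lastLetter (n + 1)) *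
      (toFree (stdWord d (n + 2)) ^ k * toFree (stdWord d (n + 1))) *
        (FreeGroup.of (lastLetter (n + 1)).swap)⁻¹ := by
  have h := congrArg toFree (palWord_append hd n k)
  rw [toFree_append, toFree_cons, toFree_cons, toFree_nil, mul_one, toFree_append,
    toFree_wpow] at h
  rw [← h, mul_inv_cancel_right]

theorem toFree_adjProd {d : ℕ → ℕ} (hd : ∀ i, 1 ≤ i → 1 ≤ d i) (n : ℕ) :
    toFree (adjProd d n) = toFree (stdWord d (n + 1)) * (FreeGroup.of (lastLetter n))⁻¹ := by
  rw [← adjProd_append hd, toFree_append, toFree_cons, toFree_nil, mul_one, mul_inv_cancel_right]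

theorem toFree_palWord_mul_palFree {d : ℕ → ℕ} (hd : ∀ i, 1 ≤ i → 1 ≤ d i) (n k : ℕ) :
    toFree (palWord d (n + 1) k) * (palFree d (n + 1) ((k : ℤ) - 1))⁻¹ =
      FreeGroup.of (lastLetter (n + 1)) * toFree (stdWord d (n + 2)) *
        (FreeGroup.of (lastLetter (n + 1)))⁻¹ := by
  rw [← palFree_natCast, ← toFree_singWord_mul_adjWord hd, palFree, palFree, mul_inv_rev,
    mul_assoc, mul_inv_cancel_left, ← zpow_neg, ← zpow_add]
  simp

theorem toFree_palWord_mul_singWord {d : ℕ → ℕ} (hd : ∀ i, 1 ≤ i → 1 ≤ d i) (n k : ℕ) :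
    toFree (palWord d (n + 1) k) * toFree (singWord d (n + 3)) =
      FreeGroup.of (lastLetter (n + 1)) * (toFree (stdWord d (n + 2)) ^ k *
        toFree (stdWord d (n + 1))) * toFree (stdWord d (n + 2)) *
          (FreeGroup.of (lastLetter (n + 1)))⁻¹ := by
  rw [toFree_palWord hd, toFree_singWord]
  group

/-- The left side is the image of the first `i` letters of `x`, then s_{n+1} without its last
letter. Each gap is a block product conjugated by that letter, so the conjugations telescope. -/
theorem toFree_apply_stdMorphism_pre {d : ℕ → ℕ} (hd : ∀ i, 1 ≤ i → 1 ≤ d i) (n k : ℕ)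
    (x : ℕ → Letter) (i : ℕ) :
    toFree (apply (stdMorphism d (n + 1) k) (apply (shear 1) (pre x i))) *
        toFree (stdWord d (n + 2)) * (FreeGroup.of (lastLetter (n + 1)))⁻¹ =
      toFree (adjProd d (n + 1)) * ((List.range i).map (fun j => toFree (palWord d (n + 1) k) *
        overAlphabet x (palFree d (n + 1) ((k : ℤ) - 1))⁻¹ (toFree (singWord d (n + 3))) j)).prod := by
  induction i with
  | zero => simp [toFree_adjProd hd, pre, apply, toFree_nil]
  | succ i ih =>
    have hs : apply (stdMorphism d (n + 1) k) (apply (shear 1) (pre x (i + 1))) =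
        apply (stdMorphism d (n + 1) k) (apply (shear 1) (pre x i)) ++
          apply (stdMorphism d (n + 1) k) (shear 1 (x i)) := by
      rw [apply_pre_succ]; simp [apply]
    rw [List.range_succ, List.map_append, List.prod_append, ← mul_assoc, ← ih, hs, toFree_append]
    generalize toFree (apply _ (apply _ _)) = A
    simp only [List.map_cons, List.map_nil, List.prod_cons, List.prod_nil, mul_one]
    cases hx : x i with
    | a =>
      simp only [overAlphabet, hx]
      rw [toFree_palWord_mul_palFree hd]
      have e : apply (stdMorphism d (n + 1) k) (shear 1 Letter.a) = stdWord d (n + 2) := by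
        simp [apply, shear, stdMorphism]
      rw [e]
      group
    | b =>
      simp only [overAlphabet, hx]
      rw [toFree_palWord_mul_singWord hd]
      have e : apply (stdMorphism d (n + 1) k) (shear 1 Letter.b) =
          stdWord d (n + 2) ++ (wpow (stdWord d (n + 2)) k ++ stdWord d (n + 1)) := by
        simp [apply, shear, stdMorphism]
      rw [e, toFree_append, toFree_append, toFree_wpow]
      group

theorem isOccurrenceDecomposition_palWord {d : ℕ → ℕ} (hd : ∀ i, 1 ≤ i → 1 ≤ d i) (n k : ℕ)
    {x y c : ℕ → Letter} (hxy : IsImage (shear 1) x y)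
    (hyc : IsImage (stdMorphism d (n + 1) k) y c) :
    IsOccurrenceDecomposition c (adjProd d (n + 1)) (palWord d (n + 1) k)
      (overAlphabet x (palFree d (n + 1) ((k : ℤ) - 1))⁻¹ (toFree (singWord d (n + 3)))) := by
  obtain ⟨V, hV, hm⟩ := marks_stdMorphism hd n k
  set τ := stdMorphism d (n + 1) k with hτ
  set t : ℕ → ℕ := fun i => (apply (shear 1) (pre x i)).length with ht
  set L : ℕ → ℕ := fun j => (apply τ (pre y j)).length with hL
  have hLmono : StrictMono L := strictMono_length_apply_pre hm.ne_nil y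
  have htmono : StrictMono t := strictMono_length_apply_pre (shear_ne_nil 1) x
  have hpos : ∀ i, L (t i + 1) - 1 + 1 = L (t i + 1) := fun i =>
    Nat.sub_add_cancel ((Nat.zero_le _).trans_lt (hLmono (Nat.lt_succ_self _)))
  have hrange : ∀ m, OccursAt (palWord d (n + 1) k) c m ↔ ∃ i, L (t i + 1) - 1 = m := by
    intro m
    rw [hV, hm.occursAt_iff hyc]
    constructor
    · rintro ⟨j, e, hj⟩
      obtain ⟨i, rfl⟩ := (hxy.eq_a_iff_shear j).1 hj
      exact ⟨i, Nat.sub_eq_of_eq_add e.symm⟩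
    · rintro ⟨i, rfl⟩
      exact ⟨t i, hpos i, hxy.shear_start i⟩
  -- `t i` is the position of the `i`-th letter a of `y`, and `L (t i + 1) - 1` that of the last
  -- letter of its block; blocks are nonempty, so the subtraction is never truncated.
  refine ⟨fun i => L (t i + 1) - 1, ?_, Set.ext fun m => (hrange m).symm, fun i => ?_⟩
  · intro i j hij
    have h1 : L (t i + 1) < L (t j + 1) := hLmono (Nat.succ_lt_succ (htmono hij))
    have h2 := hpos i
    have h3 := hpos j
    show L (t i + 1) - 1 < L (t j + 1) - 1
    omega
  · have hocc := (hrange _).2 ⟨i, rfl⟩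
    rw [hV] at hocc
    have hletter := (occursAt_cons.1 hocc).1
    have h1 : pre c (L (t i + 1)) =
        apply τ (apply (shear 1) (pre x i)) ++ stdWord d (n + 2) := by
      rw [hyc.pre_eq (t i + 1), apply_pre_succ, hxy.pre_eq i, hxy.shear_start i]
      rfl
    -- The prefix through the block s_{n+1} is the wanted prefix plus one letter, the first letter
    -- of U_{n+1,k}; cancel it in the free group.
    rw [← hpos i, pre_succ, hletter] at h1
    have h3 := congrArg toFree h1
    rw [toFree_append, toFree_append, toFree_cons, toFree_nil, mul_one] at h3
    rw [← toFree_apply_stdMorphism_pre hd, ← hτ, ← h3, mul_inv_cancel_right]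

theorem isOccurrenceDecomposition_charWord {d : ℕ → ℕ} (hd : ∀ i, 1 ≤ i → 1 ≤ d i) (n : ℕ)
    {k : ℕ} (hk : k ≤ d (n + 2) - 1) :
    IsOccurrenceDecomposition (charWord (cfVal (quotients d))) (adjProd d (n + 1))
      (palWord d (n + 1) k)
      (overAlphabet (charWord (cfShift (quotients d) (n + 1) (-(k : ℤ))))
        (palFree d (n + 1) ((k : ℤ) - 1))⁻¹ (toFree (singWord d (n + 3)))) := by
  have hd' := hd (n + 2) (by omega)
  have hj : (1 : ℤ) ≤ d (n + 2) + -(k : ℤ) := by omega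
  have h := isImage_shear_tailCf hd (n + 1) hj 1
  have e : (d (n + 2) : ℤ) + -(k : ℤ) + (1 : ℕ) = d (n + 1 + 1) + 1 - k := by push_cast; ring
  rw [e] at h
  rw [cfVal_quotients, cfShift_quotients]
  exact isOccurrenceDecomposition_palWord hd n k h
    (isImage_stdMorphism hd (n + 1) (show k ≤ d (n + 2) by omega))

theorem overAlphabet_exchange {x y : ℕ → Letter} (h : IsImage exchange x y)
    (g g' : FreeGroup Letter) : overAlphabet y g g' = overAlphabet x g' g := by
  funext i
  simp only [overAlphabet, isImage_exchange.1 h i]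
  cases x i <;> rfl

end Sturmian

theorem mainTheorem5 (d : ℕ → ℕ) (hd : ∀ i, 1 ≤ i → 1 ≤ d i)
    (α : ℝ) (hα : α = cfVal (quotients d)) :
    -- the occurrences of `U_{n,k}`
    (∀ n k : ℕ, 1 ≤ n → k ≤ d (n + 1) - 1 →
      IsOccurrenceDecomposition (charWord α) (adjProd d n) (palWord d n k)
        (overAlphabet (charWord (cfShift (quotients d) n (-(k : ℤ))))
          (palFree d n ((k : ℤ) - 1))⁻¹ (toFree (singWord d (n + 2))))) ∧
    -- the occurrences of `w_n`
    (∀ n : ℕ,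
      IsOccurrenceDecomposition (charWord α) (adjProd d (n + 1)) (singWord d (n + 2))
        (overAlphabet (charWord (cfShift (quotients d) (n + 1) 0))
          (toFree (adjWord d (n + 1))) (toFree (singWord d (n + 3))))) ∧
    -- the occurrences of `v_n`
    (∀ n : ℕ,
      IsOccurrenceDecomposition (charWord α) (adjProd d (n + 1)) (adjWord d (n + 2))
        (overAlphabet (charWord (cfShift (quotients d) (n + 2) 1))
          (toFree (singWord d (n + 3))) (palFree d (n + 1) ((d (n + 2) : ℤ) - 2))⁻¹)) := by
  subst hα
  refine ⟨fun n k hn hk => ?_, fun n => ?_, fun n => ?_⟩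
  · obtain ⟨n, rfl⟩ := Nat.exists_eq_succ_of_ne_zero (Nat.one_le_iff_ne_zero.1 hn)
    exact isOccurrenceDecomposition_charWord hd n hk
  · have h := isOccurrenceDecomposition_charWord hd n (Nat.zero_le _)
    simpa [palFree_neg_one, palWord, wpow_zero] using h
  · have h := isOccurrenceDecomposition_charWord hd n le_rfl
    have hd' := hd (n + 2) (by omega)
    rw [← adjWord_eq_palWord hd, cfShift_quotients, Nat.cast_sub hd'] at h
    have e : (d (n + 2) : ℤ) + -((d (n + 2) : ℤ) - (1 : ℕ)) = 1 := by push_cast; ring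
    have e' : (d (n + 2) : ℤ) - (1 : ℕ) - 1 = d (n + 2) - 2 := by push_cast; ring
    -- For k = d_{n+2}-1 the slope is [0;1,d_{n+3},…] = 1 - [0;d_{n+3}+1,…]; passing to the
    -- complementary slope exchanges the two letters of the alphabet.
    rw [e, e', overAlphabet_exchange (isImage_exchange_tailCf hd (n + 1))] at h
    rwa [cfShift_quotients]
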